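/- Let $\mathbb F$ be a field and $n\ge 4$. For an $n\times n$ matrix $A$ over $\mathbb F$ and $S,T\subseteq[n]$ let $A[S,T]$ be the submatrix with rows $S$ and columns $T$, $A[S]=A[S,S]$, and $\overline S=[n]\setminus S$. Call $A$ dense if all its off-diagonal entries are nonzero. A set $X\subseteq[n]$ is a cut of $A$ if $2\le|X|\le n-2$ and both $A[X,\overline X]$ and $A[\overline X,X]$ have rank at most one. $A$ has the rank-one extension property if, for all distinct $i,j,k,\ell$ with $\operatorname{rank}A[\{i,j\},\{k,\ell\}]=1$, there is $S\subseteq[n]$ with $i,j\in S$, $k,\ell\in\overline S$ and $\operatorname{rank}A[S,\overline S]=1$. Two $n\times n$ matrices $A,B$ are principal minor equivalent up to order $k$ if $\det A[S]=\det B[S]$ for all $S\subseteq[n]$ with $|S|\le k$, and principal minor equivalent if this holds for all $S\subseteq[n]$. Say that $A$ has form $(\ast)$ if $$A[\{1,2,3,4\}]=\begin{pmatrix}1&1&1&1\\2&1&1&1\\1&1&1&2\\1&1&1&1\end{pmatrix},$$ all diagonal entries of $A$ are $1$, and $A_{ij}=A_{ji}$ whenever $i\ge5$ or $j\ge5$.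 For such $A$ let $B$ be the matrix obtained from $A$ by exchanging the entries in positions $(1,2)$ and $(2,1)$ and keeping all other entries. (1) If $A$ is dense, has form $(\ast)$, and has no cut $X$ with $\{1,2\}\subseteq X$ and $\{3,4\}\subseteq\overline X$, then $A$ and $B$ are principal minor equivalent up to order $4$ but not principal minor equivalent. (2) Suppose $n\ge5$ and $2\ne0$ in $\mathbb F$. Let $A$ be the matrix whose block $A[\{1,2,3,4\}]$ is as above, with $A_{i-1,i}=A_{i,i-1}=2$ for $5\le i\le n$, $A_{1,n}=A_{n,1}=2$, and all remaining entries equal to $1$; let $B$ be obtained from it as above. Then $A$ and $B$ are dense and $A$ has form $(\ast)$; $\operatorname{rank}A[\{1,2\},\{3,4\}]=1$, but there is no $X\subseteq[n]$ with $\{1,2\}\subseteq X$, $\{3,4\}\subseteq\overline X$ and $\operatorname{rank}A[X,\overline X]=1$, so $A$ does not have the rank-one extension property; $A$ has no cut $X$ with $\{1,2\}\subseteq X$, $\{3,4\}\subseteq\overline X$; and $A$ and $B$ are principal minor equivalent up to order $n-1$ (hence up to order $4$), but not principal minor equivalent. -/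

import Mathlib

namespace PrincipalMinors

variable {F : Type*} [Field F] {n : ℕ}

/-- The submatrix `A[S, T]` with rows indexed by `S` and columns indexed by `T`. -/
def block (A : Matrix (Fin n) (Fin n) F) (S T : Finset (Fin n)) :
    Matrix {x // x ∈ S} {x // x ∈ T} F :=
  A.submatrix Subtype.val Subtype.val

/-- The principal minor `det A[S]`. -/
def principalMinor (A : Matrix (Fin n) (Fin n) F) (S : Finset (Fin n)) : F :=
  (block A S S).det

/-- All corresponding principal minors of order at most `k` are equal. -/
def PMEUpTo (k : ℕ) (A B : Matrix (Fin n) (Fin n) F) : Prop :=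
  ∀ S : Finset (Fin n), S.card ≤ k → principalMinor A S = principalMinor B S

/-- Principal minor equivalence: all corresponding principal minors are equal. -/
def PME (A B : Matrix (Fin n) (Fin n) F) : Prop :=
  ∀ S : Finset (Fin n), principalMinor A S = principalMinor B S

/-- All off-diagonal entries are nonzero. -/
def IsDense (A : Matrix (Fin n) (Fin n) F) : Prop :=
  ∀ i j, i ≠ j → A i j ≠ 0

/-- The rank-one extension property. -/
def HasRankOneExtension (A : Matrix (Fin n) (Fin n) F) : Prop :=
  ∀ i j k l : Fin n, i ≠ j → i ≠ k → i ≠ l → j ≠ k → j ≠ l → k ≠ l →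
    (block A {i, j} {k, l}).rank = 1 →
      ∃ S : Finset (Fin n), i ∈ S ∧ j ∈ S ∧ k ∈ Sᶜ ∧ l ∈ Sᶜ ∧ (block A S Sᶜ).rank = 1

/-- `X` is a cut of `A`. -/
def IsCut (A : Matrix (Fin n) (Fin n) F) (X : Finset (Fin n)) : Prop :=
  2 ≤ X.card ∧ X.card + 2 ≤ n ∧ (block A X Xᶜ).rank ≤ 1 ∧ (block A Xᶜ X).rank ≤ 1

/-- The indices `1, 2, 3, 4` of `[n]`, numbered from zero. -/
def idx (hn : 4 ≤ n) (k : Fin 4) : Fin n := Fin.castLE hn k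

variable (F) in
/-- The prescribed leading `4 × 4` block. -/
def leadingBlock : Matrix (Fin 4) (Fin 4) F :=
  !![1, 1, 1, 1;
     2, 1, 1, 1;
     1, 1, 1, 2;
     1, 1, 1, 1]

/-- `A` has the prescribed leading `4 × 4` block, all its diagonal entries are `1`, and it is
symmetric outside the leading block. -/
def HasTemplateForm (hn : 4 ≤ n) (A : Matrix (Fin n) (Fin n) F) : Prop :=
  (∀ p q : Fin 4, A (idx hn p) (idx hn q) = leadingBlock F p q) ∧
  (∀ i, A i i = 1) ∧
  (∀ i j : Fin n, 4 ≤ (i : ℕ) ∨ 4 ≤ (j : ℕ) → A i j = A j i)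

/-- The matrix obtained from `A` by exchanging the entries in the positions `(1, 2)` and `(2, 1)`
and leaving all other entries unchanged. -/
def swapEntries (hn : 4 ≤ n) (A : Matrix (Fin n) (Fin n) F) : Matrix (Fin n) (Fin n) F :=
  Matrix.of fun i j =>
    if (i = idx hn 0 ∧ j = idx hn 1) ∨ (i = idx hn 1 ∧ j = idx hn 0) then A j i else A i j

variable (F n) in
/-- The explicit matrix: the prescribed leading `4 × 4` block; outside it the entry is `2` in the
positions `(i - 1, i)`, `(i, i - 1)` for `5 ≤ i ≤ n` and `(1, n)`, `(n, 1)` (one-based), and `1`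
in all other positions. -/
def explicitMatrix : Matrix (Fin n) (Fin n) F :=
  Matrix.of fun i j =>
    if h : (i : ℕ) < 4 ∧ (j : ℕ) < 4 then leadingBlock F ⟨i, h.1⟩ ⟨j, h.2⟩
    else if (i : ℕ) + 1 = j ∨ (j : ℕ) + 1 = i ∨
        ((i : ℕ) = 0 ∧ (j : ℕ) + 1 = n) ∨ ((j : ℕ) = 0 ∧ (i : ℕ) + 1 = n) then 2
    else 1

end PrincipalMinors

open PrincipalMinors

namespace PrincipalMinors

open Matrix

/-! ### The determinant identity behind the exchange of two entries. -/

section BlockDeterminants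

open Polynomial

/-! Let indices be one-based. If `S` misses one of 1, 2, 3, 4, then `B[S]` is `A[S]` or its
transpose, so the minors agree. If `S = {1,2,3,4} ∪ T`, the two minors differ exactly by the
crossing minor of `A` with rows `{1,2} ∪ T` and columns `{3,4} ∪ T` (`det_swap`,
`principalMinor_swap`). Everything is thus a question about which crossing minors vanish.

For this, read `A` as a directed graph on the indices `≥ 5`. If `X` contains 1, 2 but not 3, 4 and
has rank one across, then `A s t = A s 3 * A 1 t` for `s ∈ X`, `t ∉ X`; a violation of this is an
edge `s → t`, since `s ∈ X` then forces `t ∈ X`. Columns telling row 1 from row 2 are sources, and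
rows telling column 3 from column 4 are sinks. If no sink is reachable from a source, then 1, 2 and
the reachable indices form a cut (`exists_cut_of_not_reachable`). Otherwise the crossing minor on a
shortest source-sink path is nonzero by triangularity (`exists_crossDet_ne_zero`).

In the explicit matrix the graph contains the path `n → n-1 → ⋯ → 5` with only source `n` and only
sink 5. It rules out a cut, while omitting any of its vertices produces a rank-one factorisation
that kills the crossing minor (`crossDet_eq_zero`). -/

theorem det_fin_four {R : Type*} [CommRing R] (M : Matrix (Fin 4) (Fin 4) R) :
    M.det =
      M 0 0 * (M 1 1 * (M 2 2 * M 3 3 - M 2 3 * M 3 2) - M 1 2 * (M 2 1 * M 3 3 - M 2 3 * M 3 1)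
        + M 1 3 * (M 2 1 * M 3 2 - M 2 2 * M 3 1))
      - M 0 1 * (M 1 0 * (M 2 2 * M 3 3 - M 2 3 * M 3 2)
        - M 1 2 * (M 2 0 * M 3 3 - M 2 3 * M 3 0) + M 1 3 * (M 2 0 * M 3 2 - M 2 2 * M 3 0))
      + M 0 2 * (M 1 0 * (M 2 1 * M 3 3 - M 2 3 * M 3 1)
        - M 1 1 * (M 2 0 * M 3 3 - M 2 3 * M 3 0) + M 1 3 * (M 2 0 * M 3 1 - M 2 1 * M 3 0))
      - M 0 3 * (M 1 0 * (M 2 1 * M 3 2 - M 2 2 * M 3 1)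
        - M 1 1 * (M 2 0 * M 3 2 - M 2 2 * M 3 0) + M 1 2 * (M 2 0 * M 3 1 - M 2 1 * M 3 0)) := by
  rw [det_succ_row_zero]
  simp [Fin.sum_univ_succ, det_fin_three, Fin.succAbove]
  ring

/-- The leading block with the entries in the first two off-diagonal positions exchanged. -/
def leadingBlockSwap (R : Type*) [CommRing R] : Matrix (Fin 4) (Fin 4) R :=
  !![1, 2, 1, 1;
     1, 1, 1, 1;
     1, 1, 1, 2;
     1, 1, 1, 1]

/-- The prescribed leading block over a commutative ring. -/
def leadingBlockRing (R : Type*) [CommRing R] : Matrix (Fin 4) (Fin 4) R :=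
  !![1, 1, 1, 1;
     2, 1, 1, 1;
     1, 1, 1, 2;
     1, 1, 1, 1]

/-- Direct expansion. Only the symmetry of `W` matters, so `W` can later be the Schur correction `Q
D⁻¹ Qᵀ`. -/
theorem det_leading_sub_symm {R : Type*} [CommRing R] (W : Matrix (Fin 4) (Fin 4) R)
    (hW : Wᵀ = W) :
    (leadingBlockSwap R - W).det = (leadingBlockRing R - W).det +
      ((leadingBlockRing R - W).submatrix ![0, 1] ![2, 3]).det := by
  have h (i j) : W i j = W j i := congrFun (congrFun hW j) i
  simp only [det_fin_four, det_fin_two, leadingBlockSwap, leadingBlockRing, Matrix.sub_apply,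
    submatrix_apply]
  simp
  rw [h 1 0, h 2 0, h 3 0, h 2 1, h 3 1, h 3 2]
  ring

variable {R τ : Type*} [CommRing R]

/-- The block whose determinant measures the effect of exchanging two entries. -/
def crossBlock (Q : Matrix (Fin 4) τ R) (D : Matrix τ τ R) : Matrix (Fin 2 ⊕ τ) (Fin 2 ⊕ τ) R :=
  fromBlocks ((leadingBlockRing R).submatrix ![0, 1] ![2, 3]) (Q.submatrix ![0, 1] id)
    (Qᵀ.submatrix id ![2, 3]) D

theorem leadingBlockRing_map {S : Type*} [CommRing S] (f : R →+* S) :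
    (leadingBlockRing R).map f = leadingBlockRing S := by
  ext i j
  fin_cases i <;> fin_cases j <;> simp [leadingBlockRing, map_ofNat f 2]

theorem leadingBlockSwap_map {S : Type*} [CommRing S] (f : R →+* S) :
    (leadingBlockSwap R).map f = leadingBlockSwap S := by
  ext i j
  fin_cases i <;> fin_cases j <;> simp [leadingBlockSwap, map_ofNat f 2]

theorem crossBlock_map {S : Type*} [CommRing S] (f : R →+* S) (Q : Matrix (Fin 4) τ R)
    (D : Matrix τ τ R) : (crossBlock Q D).map f = crossBlock (Q.map f) (D.map f) := by
  rw [crossBlock, crossBlock, fromBlocks_map, ← leadingBlockRing_map f]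
  rfl

variable [Fintype τ] [DecidableEq τ]

/-- All three determinants equal `det D` times that of a Schur complement of `D`, and the one of
`crossBlock` is the rows-1,2, columns-3,4 part of the one for the leading block. The 4 × 4 identity
then applies. -/
theorem det_swap_of_invertible (Q : Matrix (Fin 4) τ R) (D : Matrix τ τ R) (hD : Dᵀ = D)
    (h : IsUnit D.det) :
    (fromBlocks (leadingBlockSwap R) Q Qᵀ D).det =
      (fromBlocks (leadingBlockRing R) Q Qᵀ D).det + (crossBlock Q D).det := by
  have : Invertible D := invertibleOfIsUnitDet D h
  rw [crossBlock, det_fromBlocks₂₂, det_fromBlocks₂₂, det_fromBlocks₂₂, ← mul_add,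
    det_leading_sub_symm]
  · rfl
  · rw [invOf_eq_nonsing_inv]
    simp [transpose_mul, transpose_nonsing_inv, hD, Matrix.mul_assoc]

theorem det_swap_map {S : Type*} [CommRing S] (f : R →+* S) (Q : Matrix (Fin 4) τ R)
    (D : Matrix τ τ R) :
    f (fromBlocks (leadingBlockSwap R) Q Qᵀ D).det =
        (fromBlocks (leadingBlockSwap S) (Q.map f) (Q.map f)ᵀ (D.map f)).det ∧
      f (fromBlocks (leadingBlockRing R) Q Qᵀ D).det =
        (fromBlocks (leadingBlockRing S) (Q.map f) (Q.map f)ᵀ (D.map f)).det ∧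
      f (crossBlock Q D).det = (crossBlock (Q.map f) (D.map f)).det := by
  simp only [RingHom.map_det, RingHom.mapMatrix_apply, crossBlock_map, fromBlocks_map,
    leadingBlockRing_map, leadingBlockSwap_map, transpose_map, and_self]

theorem det_swap_of_det_ne_zero [IsDomain R] (Q : Matrix (Fin 4) τ R) (D : Matrix τ τ R)
    (hD : Dᵀ = D) (h : D.det ≠ 0) :
    (fromBlocks (leadingBlockSwap R) Q Qᵀ D).det =
      (fromBlocks (leadingBlockRing R) Q Qᵀ D).det + (crossBlock Q D).det := by
  have hf := IsFractionRing.injective R (FractionRing R)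
  apply hf
  obtain ⟨h1, h2, h3⟩ := det_swap_map (algebraMap R (FractionRing R)) Q D
  rw [map_add, h1, h2, h3]
  refine det_swap_of_invertible _ _ (by rw [← transpose_map, hD]) ?_
  rw [isUnit_iff_ne_zero, ← RingHom.mapMatrix_apply, ← RingHom.map_det]
  exact (map_ne_zero_iff _ hf).2 h

/-- For a matrix symmetric outside its leading block, exchanging the two entries changes the
determinant by a single minor. -/
theorem det_swap [IsDomain R] (Q : Matrix (Fin 4) τ R) (D : Matrix τ τ R) (hD : Dᵀ = D) :
    (fromBlocks (leadingBlockSwap R) Q Qᵀ D).det =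
      (fromBlocks (leadingBlockRing R) Q Qᵀ D).det + (crossBlock Q D).det := by
  -- `charmatrix (-D)` is `X • 1 + D`: its determinant is monic, hence nonzero, and evaluating at `X
  -- = 0` recovers `D`, which may itself be singular.
  have key := det_swap_of_det_ne_zero (Q.map (C : R →+* R[X])) (charmatrix (-D))
    (by rw [← charmatrix_transpose, transpose_neg, hD]) (charpoly_monic (-D)).ne_zero
  have hQ : (Q.map (C : R →+* R[X])).map (evalRingHom 0) = Q := by
    ext; simp
  have hE : (charmatrix (-D)).map (evalRingHom 0) = D := by
    ext i j; by_cases h : i = j <;> simp [h]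
  have := congrArg (evalRingHom 0) key
  obtain ⟨h1, h2, h3⟩ := det_swap_map (evalRingHom (0 : R)) (Q.map (C : R →+* R[X]))
    (charmatrix (-D))
  rwa [map_add, h1, h2, h3, hQ, hE] at this

end BlockDeterminants

/-! ### Principal minors under the exchange. -/

variable {F : Type*} [Field F] {n : ℕ}

theorem idx_injective (hn : 4 ≤ n) : Function.Injective (idx hn) :=
  Fin.castLE_injective hn

theorem idx_val_lt (hn : 4 ≤ n) (k : Fin 4) : (idx hn k : ℕ) < 4 := k.isLt

theorem exists_idx_eq (hn : 4 ≤ n) {i : Fin n} (hi : (i : ℕ) < 4) : ∃ k, idx hn k = i :=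
  ⟨⟨i, hi⟩, rfl⟩

theorem principalMinor_eq_det_submatrix {ι : Type*} [Fintype ι] [DecidableEq ι]
    (A : Matrix (Fin n) (Fin n) F) (S : Finset (Fin n)) (g : ι → Fin n)
    (hg : Function.Injective g) (hS : ∀ x, x ∈ S ↔ ∃ i, g i = x) :
    principalMinor A S = (A.submatrix g g).det := by
  let e : ι ≃ {x // x ∈ S} := Equiv.ofBijective (fun i => ⟨g i, (hS _).2 ⟨i, rfl⟩⟩)
    ⟨fun i j h => hg (congrArg Subtype.val h), fun ⟨x, hx⟩ => by
      obtain ⟨i, rfl⟩ := (hS x).1 hx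
      exact ⟨i, rfl⟩⟩
  rw [principalMinor, ← det_submatrix_equiv_self e]
  rfl

theorem principalMinor_transpose (A : Matrix (Fin n) (Fin n) F) (S : Finset (Fin n)) :
    principalMinor Aᵀ S = principalMinor A S := det_transpose _

theorem principalMinor_congr {A B : Matrix (Fin n) (Fin n) F} {S : Finset (Fin n)}
    (h : ∀ i ∈ S, ∀ j ∈ S, A i j = B i j) : principalMinor A S = principalMinor B S := by
  unfold principalMinor
  congr 1
  ext i j
  exact h i i.2 j j.2

/-- The effect on the determinant of exchanging the entries, as a minor of `A`. -/
def crossDet (hn : 4 ≤ n) (A : Matrix (Fin n) (Fin n) F) {τ : Type*} [Fintype τ]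
    [DecidableEq τ] (f : τ → Fin n) : F :=
  (A.submatrix (Sum.elim ![idx hn 0, idx hn 1] f) (Sum.elim ![idx hn 2, idx hn 3] f)).det

theorem HasTemplateForm.symm_entry {hn : 4 ≤ n} {A : Matrix (Fin n) (Fin n) F}
    (hA : HasTemplateForm hn A) {i j : Fin n}
    (h1 : ¬ ((i = idx hn 0 ∧ j = idx hn 1) ∨ (i = idx hn 1 ∧ j = idx hn 0)))
    (h2 : ¬ ((i = idx hn 2 ∧ j = idx hn 3) ∨ (i = idx hn 3 ∧ j = idx hn 2))) :
    A i j = A j i := by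
  by_cases h : 4 ≤ (i : ℕ) ∨ 4 ≤ (j : ℕ)
  · exact hA.2.2 i j h
  push Not at h
  obtain ⟨p, rfl⟩ := exists_idx_eq hn h.1
  obtain ⟨q, rfl⟩ := exists_idx_eq hn h.2
  simp only [(idx_injective hn).eq_iff] at h1 h2
  rw [hA.1, hA.1]
  fin_cases p <;> fin_cases q <;> simp_all [leadingBlock]

/-- The only asymmetric pairs of `A` are (1,2) and (3,4). If `S` contains 1 and 2, it misses 3 or 4,
so the exchange merely transposes `A[S]`; otherwise it does not touch `A[S]`. -/
theorem principalMinor_swap_of_not_subset {hn : 4 ≤ n} {A : Matrix (Fin n) (Fin n) F}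
    (hA : HasTemplateForm hn A) {S : Finset (Fin n)} (hS : ∃ k, idx hn k ∉ S) :
    principalMinor A S = principalMinor (swapEntries hn A) S := by
  by_cases h : idx hn 0 ∈ S ∧ idx hn 1 ∈ S
  · rw [← principalMinor_transpose]
    apply principalMinor_congr
    intro i hi j hj
    simp only [swapEntries, transpose_apply, of_apply]
    split_ifs with h01
    · rfl
    refine (hA.symm_entry h01 ?_).symm
    rintro (⟨rfl, rfl⟩ | ⟨rfl, rfl⟩) <;> obtain ⟨k, hk⟩ := hS <;> fin_cases k <;> simp_all
  · apply principalMinor_congr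
    intro i hi j hj
    simp only [swapEntries, of_apply]
    rw [if_neg]
    rintro (⟨rfl, rfl⟩ | ⟨rfl, rfl⟩) <;> simp_all

theorem principalMinor_swap {hn : 4 ≤ n} {A : Matrix (Fin n) (Fin n) F}
    (hA : HasTemplateForm hn A) {S : Finset (Fin n)} {τ : Type*} [Fintype τ] [DecidableEq τ]
    (f : τ → Fin n) (hf : Function.Injective f) (hf4 : ∀ t, 4 ≤ (f t : ℕ))
    (hS : ∀ x, x ∈ S ↔ (x : ℕ) < 4 ∨ ∃ t, f t = x) :
    principalMinor (swapEntries hn A) S = principalMinor A S + crossDet hn A f := by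
  have hg : Function.Injective (Sum.elim (idx hn) f) :=
    (idx_injective hn).sumElim hf fun k t h => by
      have := idx_val_lt hn k
      have := hf4 t
      rw [h] at *
      omega
  have hgS (x) : x ∈ S ↔ ∃ i, Sum.elim (idx hn) f i = x := by
    rw [hS, Sum.exists]
    refine or_congr ⟨fun h => exists_idx_eq hn h, ?_⟩ Iff.rfl
    rintro ⟨k, rfl⟩
    exact idx_val_lt hn k
  have hne (t k) : f t ≠ idx hn k := fun h => by
    have := idx_val_lt hn k
    have := hf4 t
    rw [h] at *
    omega
  rw [principalMinor_eq_det_submatrix _ S _ hg hgS, principalMinor_eq_det_submatrix _ S _ hg hgS]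
  convert det_swap (A.submatrix (idx hn) f) (A.submatrix f f) ?_ using 2
  · ext (i | i) (j | j)
    · simp only [swapEntries, submatrix_apply, Sum.elim_inl, of_apply, fromBlocks_apply₁₁, hA.1,
        (idx_injective hn).eq_iff]
      fin_cases i <;> fin_cases j <;> simp [leadingBlock, leadingBlockSwap]
    · simp [swapEntries, hne]
    · simp [swapEntries, hne, hA.2.2 (f i) _ (Or.inl (hf4 i))]
    · simp [swapEntries, hne]
  · congr 1
    ext (i | i) (j | j)
    · simp [hA.1, leadingBlock, leadingBlockRing]
    · simp
    · simp [hA.2.2 (f i) _ (Or.inl (hf4 i))]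
    · simp
  · rw [crossDet]
    congr 1
    ext (i | i) (j | j)
    · simp only [crossBlock, fromBlocks_apply₁₁, submatrix_apply, Sum.elim_inl]
      fin_cases i <;> fin_cases j <;> simp [hA.1, leadingBlock, leadingBlockRing]
    · simp only [crossBlock, fromBlocks_apply₁₂, submatrix_apply, Sum.elim_inl, Sum.elim_inr]
      fin_cases i <;> rfl
    · simp only [crossBlock, fromBlocks_apply₂₁, submatrix_apply, Sum.elim_inl, Sum.elim_inr,
        hA.2.2 (f i) _ (Or.inl (hf4 i))]
      fin_cases j <;> rfl
    · rfl
  · ext i j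
    exact hA.2.2 _ _ (Or.inl (hf4 j))

/-! ### Vanishing of crossing minors and rank-one blocks. -/

/-- If the factorisation `A s t = A s 3 * A 1 t` holds across a bipartition separating the first
two indices from the next two, then the crossing minor vanishes. -/
theorem crossDet_eq_zero {hn : 4 ≤ n} {A : Matrix (Fin n) (Fin n) F} {τ : Type*} [Fintype τ]
    [DecidableEq τ] (f : τ → Fin n) (X : Set (Fin n))
    (h0 : idx hn 0 ∈ X) (h1 : idx hn 1 ∈ X) (h2 : idx hn 2 ∉ X) (h3 : idx hn 3 ∉ X)
    (hX : ∀ s ∈ Set.range f ∪ {idx hn 0, idx hn 1}, ∀ t ∈ Set.range f ∪ {idx hn 2, idx hn 3},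
      s ∈ X → t ∉ X → A s t = A s (idx hn 2) * A (idx hn 0) t) :
    crossDet hn A f = 0 := by
  classical
  let r : Fin 2 ⊕ τ → Fin n := Sum.elim ![idx hn 0, idx hn 1] f
  let c : Fin 2 ⊕ τ → Fin n := Sum.elim ![idx hn 2, idx hn 3] f
  have hr (i) : r i ∈ Set.range f ∪ {idx hn 0, idx hn 1} := by
    rcases i with i | i
    · fin_cases i <;> simp [r]
    · simp [r]
  have hc (i) : c i ∈ Set.range f ∪ {idx hn 2, idx hn 3} := by
    rcases i with i | i
    · fin_cases i <;> simp [c]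
    · simp [c]
  -- The crossing matrix, of size `|τ| + 2`, factors through `|τ| + 1` dimensions: `none` carries
  -- the rank-one block from `X` to its complement, an index `t` with `f t ∈ X` carries its column,
  -- and any other `t` carries its row.
  let U : Matrix (Fin 2 ⊕ τ) (Option τ) F := of fun i k =>
    k.elim (if r i ∈ X then A (r i) (idx hn 2) else 0) fun t =>
      if f t ∈ X then (if r i ∈ X then A (r i) (f t) else 0) else if i = Sum.inr t then 1 else 0
  let V : Matrix (Option τ) (Fin 2 ⊕ τ) F := of fun k j =>
    k.elim (if c j ∈ X then 0 else A (idx hn 0) (c j)) fun t =>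
      if f t ∈ X then (if j = Sum.inr t then 1 else 0) else A (f t) (c j)
  have hUV : A.submatrix r c = U * V := by
    ext i j
    rw [mul_apply, Fintype.sum_option, submatrix_apply]
    simp only [U, V, of_apply, Option.elim_none, Option.elim_some]
    by_cases hi : r i ∈ X
    · by_cases hj : c j ∈ X
      · obtain ⟨t, rfl⟩ : ∃ t, j = Sum.inr t := by
          rcases j with j | t
          · fin_cases j
            · exact absurd hj h2
            · exact absurd hj h3
          · exact ⟨t, rfl⟩
        rw [Finset.sum_eq_single t]
        · have : f t ∈ X := hj
          simp [hi, this, c]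
        · intro t' _ ht
          split_ifs with h h' <;> simp_all [r]
        · simp
      · rw [Finset.sum_eq_zero]
        · simp [hi, hj, hX _ (hr i) _ (hc j) hi hj]
        · intro t _
          split_ifs with h <;> simp_all [r, c]
    · obtain ⟨t, rfl⟩ : ∃ t, i = Sum.inr t := by
        rcases i with i | t
        · fin_cases i
          · exact absurd h0 hi
          · exact absurd h1 hi
        · exact ⟨t, rfl⟩
      rw [Finset.sum_eq_single t]
      · have : f t ∉ X := hi
        simp [this, r]
      · intro t' _ ht
        split_ifs <;> simp_all [r, eq_comm]
      · simp
  by_contra h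
  have h1 := rank_of_det_ne_zero h
  change (A.submatrix r c).rank = _ at h1
  rw [hUV] at h1
  have h2 := (rank_mul_le_left U V).trans (rank_le_card_width U)
  rw [h1] at h2
  simp at h2
  omega

theorem entry_mul_entry_of_rank_block_le_one {A : Matrix (Fin n) (Fin n) F}
    {S T : Finset (Fin n)} (h : (block A S T).rank ≤ 1) {s s' t t' : Fin n} (hs : s ∈ S)
    (hs' : s' ∈ S) (ht : t ∈ T) (ht' : t' ∈ T) : A s t * A s' t' = A s t' * A s' t := by
  rw [rank_eq_finrank_span_cols, finrank_le_one_iff] at h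
  obtain ⟨v, hv⟩ := h
  have key (u) (hu : u ∈ T) : ∃ a : F, ∀ i (hi : i ∈ S), A i u = a * v.1 ⟨i, hi⟩ := by
    obtain ⟨a, ha⟩ := hv ⟨(block A S T).col ⟨u, hu⟩, Submodule.subset_span ⟨_, rfl⟩⟩
    refine ⟨a, fun i hi => ?_⟩
    exact (congrFun (congrArg Subtype.val ha) ⟨i, hi⟩).symm
  obtain ⟨a, ha⟩ := key t ht
  obtain ⟨b, hb⟩ := key t' ht'
  rw [ha _ hs, ha _ hs', hb _ hs, hb _ hs']
  ring

theorem rank_block_le_one {A : Matrix (Fin n) (Fin n) F} {S T : Finset (Fin n)}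
    (u v : Fin n → F) (h : ∀ s ∈ S, ∀ t ∈ T, A s t = u s * v t) : (block A S T).rank ≤ 1 := by
  have : block A S T = vecMulVec (fun s : S => u s) (fun t : T => v t) := by
    ext s t
    exact h s s.2 t t.2
  rw [this]
  exact rank_vecMulVec_le _ _

theorem rank_block_eq_one {A : Matrix (Fin n) (Fin n) F} {S T : Finset (Fin n)}
    (u v : Fin n → F) (h : ∀ s ∈ S, ∀ t ∈ T, A s t = u s * v t) {s t : Fin n} (hs : s ∈ S)
    (ht : t ∈ T) (hst : A s t ≠ 0) : (block A S T).rank = 1 := by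
  refine (rank_block_le_one u v h).antisymm (Nat.one_le_iff_ne_zero.2 fun h0 => hst ?_)
  rw [rank_eq_finrank_span_cols, Submodule.finrank_eq_zero, Submodule.span_eq_bot] at h0
  exact congrFun (h0 _ ⟨⟨t, ht⟩, rfl⟩) ⟨s, hs⟩

/-! ### Reachability and cuts. -/

/-- The relation of forced membership: if `s` lies on the side of the first two indices in a
cut, then so does `t`. -/
def Forces (hn : 4 ≤ n) (A : Matrix (Fin n) (Fin n) F) (s t : Fin n) : Prop :=
  4 ≤ (s : ℕ) ∧ 4 ≤ (t : ℕ) ∧ A s t ≠ A s (idx hn 2) * A (idx hn 0) t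

/-- The indices that are forced to the side of the first two indices. -/
def IsSource (hn : 4 ≤ n) (A : Matrix (Fin n) (Fin n) F) (t : Fin n) : Prop :=
  4 ≤ (t : ℕ) ∧ A (idx hn 0) t ≠ A (idx hn 1) t

/-- The indices that are forced to the side of the third and fourth index. -/
def IsSink (hn : 4 ≤ n) (A : Matrix (Fin n) (Fin n) F) (t : Fin n) : Prop :=
  4 ≤ (t : ℕ) ∧ A t (idx hn 2) ≠ A t (idx hn 3)

/-- The set of 1, 2 and everything reachable from a source is closed under forcing and contains no
sink, which is precisely the factorisation across it. -/
theorem exists_cut_of_not_reachable {hn : 4 ≤ n} {A : Matrix (Fin n) (Fin n) F}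
    (hA : HasTemplateForm hn A)
    (h : ∀ p q, IsSource hn A p → Relation.ReflTransGen (Forces hn A) p q → ¬ IsSink hn A q) :
    ∃ X : Finset (Fin n), IsCut A X ∧
      idx hn 0 ∈ X ∧ idx hn 1 ∈ X ∧ idx hn 2 ∈ Xᶜ ∧ idx hn 3 ∈ Xᶜ := by
  classical
  let R (t : Fin n) : Prop :=
    ∃ p, IsSource hn A p ∧ Relation.ReflTransGen (Forces hn A) p t
  have hR4 (t) (ht : R t) : 4 ≤ (t : ℕ) := by
    obtain ⟨p, hp, hpt⟩ := ht
    rcases hpt.cases_tail with rfl | ⟨_, _, hc⟩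
    · exact hp.1
    · exact hc.2.1
  let X : Finset (Fin n) := Finset.univ.filter fun t => t = idx hn 0 ∨ t = idx hn 1 ∨ R t
  have mem_X (t) : t ∈ X ↔ t = idx hn 0 ∨ t = idx hn 1 ∨ R t := by simp [X]
  have h0 : idx hn 0 ∈ X := by simp [mem_X]
  have h1 : idx hn 1 ∈ X := by simp [mem_X]
  have hk (k : Fin 4) (hk : 2 ≤ k) : idx hn k ∉ X := by
    rw [mem_X, (idx_injective hn).eq_iff, (idx_injective hn).eq_iff]
    rintro (rfl | rfl | hr)
    · exact absurd hk (by decide)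
    · exact absurd hk (by decide)
    · have := hR4 _ hr
      have := idx_val_lt hn k
      omega
  have h2 := hk 2 le_rfl
  have h3 := hk 3 (by decide)
  have hlow (t : Fin n) (ht : t ∉ X) (ht4 : ¬ 4 ≤ (t : ℕ)) : t = idx hn 2 ∨ t = idx hn 3 := by
    obtain ⟨k, rfl⟩ := exists_idx_eq hn (not_le.1 ht4)
    fin_cases k
    · exact absurd h0 ht
    · exact absurd h1 ht
    · exact Or.inl rfl
    · exact Or.inr rfl
  have key : ∀ s ∈ X, ∀ t ∈ Xᶜ, A s t = A s (idx hn 2) * A (idx hn 0) t := by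
    intro s hs t ht
    rw [Finset.mem_compl] at ht
    have hsrc (h4 : 4 ≤ (t : ℕ)) : A (idx hn 0) t = A (idx hn 1) t := by
      by_contra hne
      exact ht ((mem_X t).2 (Or.inr (Or.inr ⟨t, ⟨h4, hne⟩, .refl⟩)))
    rcases (mem_X s).1 hs with rfl | rfl | hr
    · simp [hA.1, leadingBlock]
    · by_cases h4 : 4 ≤ (t : ℕ)
      · simp [hA.1, leadingBlock, hsrc h4]
      · rcases hlow t ht h4 with rfl | rfl <;> simp [hA.1, leadingBlock]
    · by_cases h4 : 4 ≤ (t : ℕ)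
      · by_contra hne
        obtain ⟨p, hp, hps⟩ := hr
        exact ht ((mem_X t).2 (Or.inr (Or.inr ⟨p, hp, hps.tail ⟨hR4 s ⟨p, hp, hps⟩, h4, hne⟩⟩)))
      · rcases hlow t ht h4 with rfl | rfl
        · simp [hA.1, leadingBlock]
        · obtain ⟨p, hp, hps⟩ := hr
          have hns : A s (idx hn 2) = A s (idx hn 3) := by
            by_contra hne
            exact h p s hp hps ⟨hR4 s ⟨p, hp, hps⟩, hne⟩
          simp [hA.1, leadingBlock, hns]
  have h01 : idx hn 0 ≠ idx hn 1 := (idx_injective hn).ne (by decide)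
  have h23 : idx hn 2 ≠ idx hn 3 := (idx_injective hn).ne (by decide)
  refine ⟨X, ⟨?_, ?_, rank_block_le_one _ _ key, ?_⟩, h0, h1, by simpa using h2,
    by simpa using h3⟩
  · rw [← Finset.card_pair h01]
    exact Finset.card_le_card (by simp [Finset.insert_subset_iff, h0, h1])
  · have : 2 ≤ Xᶜ.card := by
      rw [← Finset.card_pair h23]
      exact Finset.card_le_card (by simp [Finset.insert_subset_iff, h2, h3])
    rw [Finset.card_compl, Fintype.card_fin] at this
    omega
  -- The opposite block is the transpose: each asymmetric pair lies on a single side of `X`.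
  · refine rank_block_le_one (fun t => A (idx hn 0) t) (fun s => A s (idx hn 2)) ?_
    intro t ht s hs
    rw [mul_comm, ← key s hs t ht]
    rw [Finset.mem_compl] at ht
    apply hA.symm_entry <;> rintro (⟨rfl, rfl⟩ | ⟨rfl, rfl⟩) <;> contradiction

/-! ### Shortest paths and nonvanishing crossing minors. -/

theorem exists_path_of_reflTransGen {α : Type*} {r : α → α → Prop} {a b : α}
    (h : Relation.ReflTransGen r a b) :
    ∃ (k : ℕ) (p : ℕ → α), p 0 = a ∧ p k = b ∧ ∀ i < k, r (p i) (p (i + 1)) := by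
  induction h using Relation.ReflTransGen.head_induction_on with
  | refl => exact ⟨0, fun _ => b, rfl, rfl, by simp⟩
  | @head a c hac _ ih =>
    obtain ⟨k, p, hp0, hpk, hp⟩ := ih
    refine ⟨k + 1, fun i => i.casesOn a p, rfl, hpk, fun i hi => ?_⟩
    cases i with
    | zero => simpa [hp0] using hac
    | succ i => exact hp i (by omega)

/-- A shortest path between two sets of vertices meets them only at its ends and has no
shortcuts. -/
theorem exists_shortest_path {α : Type*} {r : α → α → Prop} {P Q : α → Prop} {a b : α}
    (ha : P a) (hb : Q b) (h : Relation.ReflTransGen r a b) :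
    ∃ (k : ℕ) (p : ℕ → α), P (p 0) ∧ Q (p k) ∧ (∀ i < k, r (p i) (p (i + 1))) ∧
      (∀ i ≤ k, P (p i) → i = 0) ∧ (∀ i ≤ k, Q (p i) → i = k) ∧
      (∀ i j, i + 1 < j → j ≤ k → ¬ r (p i) (p j)) := by
  classical
  have hex : ∃ (k : ℕ) (p : ℕ → α), P (p 0) ∧ Q (p k) ∧ ∀ i < k, r (p i) (p (i + 1)) := by
    obtain ⟨k, p, rfl, rfl, hp⟩ := exists_path_of_reflTransGen h
    exact ⟨k, p, ha, hb, hp⟩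
  obtain ⟨p, hP, hQ, hp⟩ := Nat.find_spec hex
  have hmin {m : ℕ} (hm : m < Nat.find hex) := Nat.find_min hex hm
  generalize Nat.find hex = k at *
  refine ⟨k, p, hP, hQ, hp, fun i hi hPi => ?_, fun i hi hQi => ?_, fun i j hij hj hr => ?_⟩
  · by_contra h0
    refine hmin (m := k - i) (by omega) ⟨fun j => p (i + j), hPi, ?_, fun j hj => ?_⟩
    · simpa [show i + (k - i) = k by omega] using hQ
    · exact hp (i + j) (by omega)
  · by_contra h0
    exact hmin (m := i) (by omega) ⟨p, hP, hQi, fun j hj => hp j (by omega)⟩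
  · refine hmin (m := k - (j - i - 1)) (by omega)
      ⟨fun l => if l ≤ i then p l else p (l + (j - i - 1)), ?_, ?_, fun l hl => ?_⟩ <;> beta_reduce
    · simpa using hP
    · rw [if_neg (by omega), show k - (j - i - 1) + (j - i - 1) = k by omega]
      exact hQ
    · rcases lt_trichotomy l i with hl' | rfl | hl'
      · rw [if_pos (by omega), if_pos (by omega)]
        exact hp l (by omega)
      · rw [if_pos le_rfl, if_neg (by omega), show l + 1 + (j - l - 1) = j by omega]
        exact hr
      · rw [if_neg (by omega), if_neg (by omega),
          show l + 1 + (j - i - 1) = l + (j - i - 1) + 1 by omega]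
        exact hp _ (by omega)

/-- On a shortest source-sink path, row operations make the system for a kernel vector triangular
with nonzero pivots: the source condition, the edges of the path and the sink condition. -/
theorem exists_crossDet_ne_zero {hn : 4 ≤ n} {A : Matrix (Fin n) (Fin n) F}
    (hA : HasTemplateForm hn A) {p q : Fin n} (hp : IsSource hn A p) (hq : IsSink hn A q)
    (h : Relation.ReflTransGen (Forces hn A) p q) :
    ∃ (k : ℕ) (f : Fin k → Fin n), Function.Injective f ∧ (∀ t, 4 ≤ (f t : ℕ)) ∧
      crossDet hn A f ≠ 0 := by
  obtain ⟨k, p, hP, hQ, hr, hP', hQ', hskip⟩ := exists_shortest_path hp hq h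
  have hp4 (i) (hi : i ≤ k) : 4 ≤ (p i : ℕ) := by
    rcases hi.lt_or_eq with hi | rfl
    · exact (hr i hi).1
    · exact hQ.1
  -- A repeated vertex would give a shortcut to the successor of the second occurrence, or a sink
  -- before the end.
  have hinj (i j) (hij : i < j) (hj : j ≤ k) : p i ≠ p j := by
    intro he
    rcases hj.lt_or_eq with hj | rfl
    · exact hskip i (j + 1) (by omega) (by omega) (he ▸ hr j hj)
    · exact hij.ne (hQ' i (by omega) (he ▸ hQ))
  refine ⟨k + 1, fun i => p i, fun i j hij => ?_, fun t => hp4 t (by omega), ?_⟩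
  · rcases lt_trichotomy (i : ℕ) j with h | h | h
    · exact absurd hij (hinj i j h (by omega))
    · exact Fin.ext h
    · exact absurd hij.symm (hinj j i h (by omega))
  intro hdet
  obtain ⟨v, hv0, hv⟩ := exists_mulVec_eq_zero_iff.2 hdet
  apply hv0
  have row0 : v (Sum.inl 0) + v (Sum.inl 1) +
      ∑ j : Fin (k + 1), A (idx hn 0) (p j) * v (Sum.inr j) = 0 := by
    have := congrFun hv (Sum.inl 0)
    simpa [mulVec, dotProduct, hA.1, leadingBlock] using this
  have row1 : v (Sum.inl 0) + v (Sum.inl 1) +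
      ∑ j : Fin (k + 1), A (idx hn 1) (p j) * v (Sum.inr j) = 0 := by
    have := congrFun hv (Sum.inl 1)
    simpa [mulVec, dotProduct, hA.1, leadingBlock] using this
  have rowp (i : Fin (k + 1)) : A (p i) (idx hn 2) * v (Sum.inl 0) +
      A (p i) (idx hn 3) * v (Sum.inl 1) +
      ∑ j : Fin (k + 1), A (p i) (p j) * v (Sum.inr j) = 0 := by
    have := congrFun hv (Sum.inr i)
    simpa [mulVec, dotProduct] using this
  have hfirst : ∑ j : Fin (k + 1), (A (idx hn 0) (p j) - A (idx hn 1) (p j)) * v (Sum.inr j) = 0 := by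
    simp only [sub_mul, Finset.sum_sub_distrib]
    linear_combination row0 - row1
  -- Subtracting `A (p i) (idx hn 2)` times the first row removes `v (Sum.inl 0)`; the remaining
  -- coefficients are nonzero exactly at sinks and at edges.
  have hrow (i : Fin (k + 1)) :
      (A (p i) (idx hn 3) - A (p i) (idx hn 2)) * v (Sum.inl 1) +
      ∑ j : Fin (k + 1),
        (A (p i) (p j) - A (p i) (idx hn 2) * A (idx hn 0) (p j)) * v (Sum.inr j) = 0 := by
    simp only [sub_mul, Finset.sum_sub_distrib, mul_assoc, ← Finset.mul_sum]
    linear_combination rowp i - A (p i) (idx hn 2) * row0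
  -- The source equation gives coordinate 0, and the row of `p m` gives coordinate `m + 1`: earlier
  -- coordinates already vanish, and later coefficients vanish for lack of shortcuts.
  have hy : ∀ m, ∀ hm : m < k + 1, v (Sum.inr ⟨m, hm⟩) = 0 := by
    intro m
    induction m using Nat.strong_induction_on with
    | _ m ih =>
    intro hm
    cases m with
    | zero =>
      rw [Finset.sum_eq_single ⟨0, hm⟩ _ (by simp)] at hfirst
      · exact (mul_eq_zero.1 hfirst).resolve_left (sub_ne_zero.2 hP.2)
      · intro j _ hj
        have : A (idx hn 0) (p j) = A (idx hn 1) (p j) := by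
          by_contra hne
          exact hj (Fin.ext (hP' j (by omega) ⟨hp4 j (by omega), hne⟩))
        simp [this]
    | succ m =>
      have := hrow ⟨m, by omega⟩
      have hns : A (p m) (idx hn 2) = A (p m) (idx hn 3) := by
        by_contra hne
        have := hQ' m (by omega) ⟨hp4 m (by omega), hne⟩
        omega
      rw [Finset.sum_eq_single ⟨m + 1, hm⟩ _ (by simp)] at this
      · simp only [hns, sub_self, zero_mul, zero_add] at this
        rw [← hns] at this
        exact (mul_eq_zero.1 this).resolve_left (sub_ne_zero.2 (hr m (by omega)).2.2)
      · intro j _ hj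
        rcases lt_trichotomy (j : ℕ) (m + 1) with h | h | h
        · simp [ih j h j.2]
        · exact absurd (Fin.ext h) hj
        · have : A (p m) (p j) = A (p m) (idx hn 2) * A (idx hn 0) (p j) := by
            by_contra hne
            exact hskip m j h (by omega) ⟨hp4 m (by omega), hp4 j (by omega), hne⟩
          simp [this]
  have hy' (j : Fin (k + 1)) : v (Sum.inr j) = 0 := hy j j.2
  have h1 : v (Sum.inl 1) = 0 := by
    have := hrow (Fin.last k)
    simp only [hy', mul_zero, Finset.sum_const_zero, add_zero] at this
    exact (mul_eq_zero.1 this).resolve_left (sub_ne_zero.2 (Ne.symm hQ.2))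
  have h0 : v (Sum.inl 0) = 0 := by simpa [hy', h1] using row0
  ext (i | j)
  · fin_cases i
    · exact h0
    · exact h1
  · exact hy' j

theorem not_pme_swap {hn : 4 ≤ n} {A : Matrix (Fin n) (Fin n) F} (hA : HasTemplateForm hn A)
    (hX : ¬ ∃ X : Finset (Fin n), IsCut A X ∧
      idx hn 0 ∈ X ∧ idx hn 1 ∈ X ∧ idx hn 2 ∈ Xᶜ ∧ idx hn 3 ∈ Xᶜ) :
    ¬ PME A (swapEntries hn A) := by
  classical
  intro h
  refine hX (exists_cut_of_not_reachable hA fun p q hp hpq hq => ?_)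
  obtain ⟨k, f, hf, hf4, hne⟩ := exists_crossDet_ne_zero hA hp hq hpq
  have := principalMinor_swap (S := Finset.univ.filter fun x => (x : ℕ) < 4 ∨ ∃ t, f t = x)
    hA f hf hf4 (by simp)
  rw [← h] at this
  exact hne (by simpa using this)

theorem principalMinor_swap_of_subset {hn : 4 ≤ n} {A : Matrix (Fin n) (Fin n) F}
    (hA : HasTemplateForm hn A) {S : Finset (Fin n)} (hS : ∀ k, idx hn k ∈ S)
    (h : crossDet hn A (fun t : {x // x ∈ S ∧ 4 ≤ (x : ℕ)} => (t : Fin n)) = 0) :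
    principalMinor A S = principalMinor (swapEntries hn A) S := by
  rw [principalMinor_swap hA _ Subtype.val_injective (fun t : {x // x ∈ S ∧ 4 ≤ (x : ℕ)} => t.2.2), h, add_zero]
  intro x
  by_cases hx : (x : ℕ) < 4
  · obtain ⟨k, rfl⟩ := exists_idx_eq hn hx
    simp [hS, hx]
  · simp [not_lt.1 hx, hx]

theorem pmeUpTo_four_swap {hn : 4 ≤ n} {A : Matrix (Fin n) (Fin n) F}
    (hA : HasTemplateForm hn A) : PMEUpTo 4 A (swapEntries hn A) := by
  intro S hS
  by_cases h : ∃ k, idx hn k ∉ S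
  · exact principalMinor_swap_of_not_subset hA h
  push Not at h
  refine principalMinor_swap_of_subset hA h ?_
  have hI : Finset.univ.image (idx hn) = S := by
    refine Finset.eq_of_subset_of_card_le (fun x hx => ?_) ?_
    · obtain ⟨k, -, rfl⟩ := Finset.mem_image.1 hx
      exact h k
    · rwa [Finset.card_image_of_injective _ (idx_injective hn), Finset.card_fin]
  have : IsEmpty {x // x ∈ S ∧ 4 ≤ (x : ℕ)} := by
    refine ⟨fun ⟨x, hx, hx4⟩ => ?_⟩
    rw [← hI] at hx
    obtain ⟨k, -, rfl⟩ := Finset.mem_image.1 hx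
    exact absurd (idx_val_lt hn k) (not_lt.2 hx4)
  refine crossDet_eq_zero _ {idx hn 0, idx hn 1} (by simp) (by simp)
    (by simp [(idx_injective hn).eq_iff]) (by simp [(idx_injective hn).eq_iff]) ?_
  rintro s hs t ht - -
  simp only [Set.range_eq_empty, Set.empty_union, Set.mem_insert_iff,
    Set.mem_singleton_iff] at hs ht
  rcases hs with rfl | rfl <;> rcases ht with rfl | rfl <;> simp [hA.1, leadingBlock]

/-! ### The explicit matrix. -/

theorem explicitMatrix_apply_of_four_le {i j : Fin n} (h : 4 ≤ (i : ℕ) ∨ 4 ≤ (j : ℕ)) :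
    explicitMatrix F n i j = if (i : ℕ) + 1 = j ∨ (j : ℕ) + 1 = i ∨
      ((i : ℕ) = 0 ∧ (j : ℕ) + 1 = n) ∨ ((j : ℕ) = 0 ∧ (i : ℕ) + 1 = n) then 2 else 1 := by
  rw [explicitMatrix, of_apply, dif_neg (by omega)]

theorem hasTemplateForm_explicitMatrix (hn : 4 ≤ n) : HasTemplateForm hn (explicitMatrix F n) := by
  have hlead (p q : Fin 4) : explicitMatrix F n (idx hn p) (idx hn q) = leadingBlock F p q := by
    rw [explicitMatrix, of_apply, dif_pos ⟨idx_val_lt hn p, idx_val_lt hn q⟩]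
    rfl
  refine ⟨hlead, fun i => ?_, fun i j h => ?_⟩
  · by_cases hi : 4 ≤ (i : ℕ)
    · rw [explicitMatrix_apply_of_four_le (Or.inl hi), if_neg (by omega)]
    · obtain ⟨k, rfl⟩ := exists_idx_eq hn (not_le.1 hi)
      rw [hlead]
      fin_cases k <;> rfl
  · rw [explicitMatrix_apply_of_four_le h, explicitMatrix_apply_of_four_le h.symm]
    exact if_congr (by omega) rfl rfl

theorem isDense_explicitMatrix (hn : 4 ≤ n) (h2 : (2 : F) ≠ 0) : IsDense (explicitMatrix F n) := by
  intro i j _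
  by_cases h : 4 ≤ (i : ℕ) ∨ 4 ≤ (j : ℕ)
  · rw [explicitMatrix_apply_of_four_le h]
    split_ifs <;> simp [h2]
  · push Not at h
    obtain ⟨p, rfl⟩ := exists_idx_eq hn h.1
    obtain ⟨q, rfl⟩ := exists_idx_eq hn h.2
    rw [(hasTemplateForm_explicitMatrix hn).1]
    fin_cases p <;> fin_cases q <;> simp [leadingBlock, h2]

theorem IsDense.swapEntries {hn : 4 ≤ n} {A : Matrix (Fin n) (Fin n) F} (hA : IsDense A) :
    IsDense (swapEntries hn A) := by
  intro i j hij
  rw [PrincipalMinors.swapEntries, of_apply]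
  split_ifs
  · exact hA j i hij.symm
  · exact hA i j hij

theorem explicitMatrix_idx_zero (hn : 4 ≤ n) {t : Fin n} (ht : 4 ≤ (t : ℕ)) :
    explicitMatrix F n (idx hn 0) t = if (t : ℕ) + 1 = n then 2 else 1 := by
  have h : (idx hn 0 : ℕ) = 0 := rfl
  rw [explicitMatrix_apply_of_four_le (Or.inr ht), h]
  exact if_congr (by omega) rfl rfl

theorem explicitMatrix_idx_one (hn : 4 ≤ n) {t : Fin n} (ht : 4 ≤ (t : ℕ)) :
    explicitMatrix F n (idx hn 1) t = 1 := by
  have h : (idx hn 1 : ℕ) = 1 := rfl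
  rw [explicitMatrix_apply_of_four_le (Or.inr ht), h, if_neg (by omega)]

theorem explicitMatrix_idx_two (hn : 4 ≤ n) {s : Fin n} (hs : 4 ≤ (s : ℕ)) :
    explicitMatrix F n s (idx hn 2) = 1 := by
  have h : (idx hn 2 : ℕ) = 2 := rfl
  rw [explicitMatrix_apply_of_four_le (Or.inl hs), h, if_neg (by omega)]

theorem explicitMatrix_idx_three (hn : 4 ≤ n) {s : Fin n} (hs : 4 ≤ (s : ℕ)) :
    explicitMatrix F n s (idx hn 3) = if (s : ℕ) = 4 then 2 else 1 := by
  have h : (idx hn 3 : ℕ) = 3 := rfl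
  rw [explicitMatrix_apply_of_four_le (Or.inl hs), h]
  exact if_congr (by omega) rfl rfl

theorem not_rank_block_explicitMatrix_le_one (hn : 4 ≤ n) (hn5 : 5 ≤ n) (X : Finset (Fin n))
    (h0 : idx hn 0 ∈ X) (h1 : idx hn 1 ∈ X) (h2 : idx hn 2 ∈ Xᶜ) (h3 : idx hn 3 ∈ Xᶜ) :
    ¬ (block (explicitMatrix F n) X Xᶜ).rank ≤ 1 := by
  intro hX
  have hA := hasTemplateForm_explicitMatrix (F := F) hn
  have h21 : (2 : F) ≠ 1 := by simp [← one_add_one_eq_two]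
  have key {s t : Fin n} (hs : s ∈ X) (ht : t ∉ X) :
      explicitMatrix F n s t =
        explicitMatrix F n s (idx hn 2) * explicitMatrix F n (idx hn 0) t := by
    have := entry_mul_entry_of_rank_block_le_one hX hs h0 (Finset.mem_compl.2 ht) h2
    simpa [hA.1, leadingBlock] using this
  -- Forcing starts at the last index, the source, and descends; `d` is the distance from it.
  -- Reaching value 4, the sink, contradicts `idx hn 3 ∉ X`.
  have hmem : ∀ d : ℕ, ∀ t : Fin n, 4 ≤ (t : ℕ) → (t : ℕ) + d + 1 = n → t ∈ X := by
    intro d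
    induction d with
    | zero =>
      intro t ht hd
      by_contra hX
      have := key h1 hX
      rw [explicitMatrix_idx_one hn ht, explicitMatrix_idx_zero hn ht, if_pos hd, hA.1] at this
      exact h21 (by simpa [leadingBlock] using this.symm)
    | succ d ih =>
      intro t ht hd
      by_contra hX
      let s : Fin n := ⟨t + 1, by omega⟩
      have hs : (s : ℕ) = t + 1 := rfl
      have := key (ih s (by omega) (by omega)) hX
      rw [explicitMatrix_idx_two hn (by omega), explicitMatrix_idx_zero hn ht,
        if_neg (by omega), explicitMatrix_apply_of_four_le (Or.inr ht), if_pos (by omega)] at this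
      exact h21 (by simpa using this)
  have h4 := hmem (n - 5) ⟨4, hn5⟩ le_rfl (by simp; omega)
  have := key h4 (Finset.mem_compl.1 h3)
  rw [explicitMatrix_idx_two hn le_rfl, explicitMatrix_idx_three hn le_rfl, if_pos rfl,
    hA.1] at this
  exact h21 (by simpa [leadingBlock] using this)

theorem pmeUpTo_explicitMatrix_swap (hn : 4 ≤ n) :
    PMEUpTo (n - 1) (explicitMatrix F n) (swapEntries hn (explicitMatrix F n)) := by
  have hA := hasTemplateForm_explicitMatrix (F := F) hn
  intro S hS
  by_cases h : ∃ k, idx hn k ∉ S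
  · exact principalMinor_swap_of_not_subset hA h
  push Not at h
  obtain ⟨m, hm⟩ : ∃ m, m ∉ S := by
    by_contra! hall
    rw [Finset.eq_univ_of_forall hall, Finset.card_fin] at hS
    omega
  have hm4 : 4 ≤ (m : ℕ) := by
    by_contra hlt
    obtain ⟨k, rfl⟩ := exists_idx_eq hn (not_le.1 hlt)
    exact hm (h k)
  -- The missing `m` breaks the path: selected indices above `m` join the source side, those below
  -- it the sink side, and no edge leads from the former to the latter.
  refine principalMinor_swap_of_subset hA h (crossDet_eq_zero _
    {x | x = idx hn 0 ∨ x = idx hn 1 ∨ m < x} (by simp) (by simp) ?_ ?_ ?_)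
  · have : ¬ m < idx hn 2 := fun hlt => by
      have := idx_val_lt hn 2
      rw [Fin.lt_def] at hlt
      omega
    simp [(idx_injective hn).eq_iff, this]
  · have : ¬ m < idx hn 3 := fun hlt => by
      have := idx_val_lt hn 3
      rw [Fin.lt_def] at hlt
      omega
    simp [(idx_injective hn).eq_iff, this]
  intro s _ t ht hsX htX
  have ht' : t = idx hn 2 ∨ t = idx hn 3 ∨ (4 ≤ (t : ℕ) ∧ (t : ℕ) < m) := by
    rcases ht with ⟨⟨t, htS, ht4⟩, rfl⟩ | ht
    · refine Or.inr (Or.inr ⟨ht4, ?_⟩)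
      have hne : t ≠ m := fun he => hm (he ▸ htS)
      have hle : ¬ m < t := fun hlt => htX (Or.inr (Or.inr hlt))
      have hlt : t < m := lt_of_le_of_ne (not_lt.1 hle) hne
      exact hlt
    · simp only [Set.mem_insert_iff, Set.mem_singleton_iff] at ht
      tauto
  have hmn := m.isLt
  rcases hsX with rfl | rfl | hs
  · rcases ht' with rfl | rfl | ht' <;> simp [hA.1, leadingBlock]
  · rcases ht' with rfl | rfl | ht'
    · simp [hA.1, leadingBlock]
    · simp [hA.1, leadingBlock]
    · rw [explicitMatrix_idx_one hn ht'.1, explicitMatrix_idx_zero hn ht'.1, if_neg (by omega)]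
      simp [hA.1, leadingBlock]
  · have hs : (m : ℕ) < s := hs
    rw [explicitMatrix_idx_two hn (by omega)]
    rcases ht' with rfl | rfl | ht'
    · rw [explicitMatrix_idx_two hn (by omega)]
      simp [hA.1, leadingBlock]
    · rw [explicitMatrix_idx_three hn (by omega), if_neg (by omega)]
      simp [hA.1, leadingBlock]
    · rw [explicitMatrix_idx_zero hn ht'.1, if_neg (by omega),
        explicitMatrix_apply_of_four_le (Or.inr ht'.1), if_neg (by omega), one_mul]

end PrincipalMinors

theorem mainTheorem10 (F : Type*) [Field F] (n : ℕ) (hn : 4 ≤ n) :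
    -- the claim, for every matrix of the given form
    (∀ A B : Matrix (Fin n) (Fin n) F,
      IsDense A → HasTemplateForm hn A →
      (¬ ∃ X : Finset (Fin n), IsCut A X ∧
        idx hn 0 ∈ X ∧ idx hn 1 ∈ X ∧ idx hn 2 ∈ Xᶜ ∧ idx hn 3 ∈ Xᶜ) →
      B = swapEntries hn A →
      PMEUpTo 4 A B ∧ ¬ PME A B) ∧
    -- the explicit pair of matrices
    (5 ≤ n → (2 : F) ≠ 0 →
      ∀ A B : Matrix (Fin n) (Fin n) F,
      A = explicitMatrix F n → B = swapEntries hn A →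
      IsDense A ∧ IsDense B ∧ HasTemplateForm hn A ∧
      (block A {idx hn 0, idx hn 1} {idx hn 2, idx hn 3}).rank = 1 ∧
      (¬ ∃ X : Finset (Fin n),
        idx hn 0 ∈ X ∧ idx hn 1 ∈ X ∧ idx hn 2 ∈ Xᶜ ∧ idx hn 3 ∈ Xᶜ ∧
          (block A X Xᶜ).rank = 1) ∧
      ¬ HasRankOneExtension A ∧
      (¬ ∃ X : Finset (Fin n), IsCut A X ∧
        idx hn 0 ∈ X ∧ idx hn 1 ∈ X ∧ idx hn 2 ∈ Xᶜ ∧ idx hn 3 ∈ Xᶜ) ∧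
      PMEUpTo (n - 1) A B ∧ PMEUpTo 4 A B ∧ ¬ PME A B) := by

  refine ⟨?_, ?_⟩
  · rintro A B - hA hX rfl
    exact ⟨pmeUpTo_four_swap hA, not_pme_swap hA hX⟩
  rintro hn5 h2 A B rfl rfl
  have hA := hasTemplateForm_explicitMatrix (F := F) hn
  have hD := isDense_explicitMatrix (F := F) hn h2
  have hrank : (block (explicitMatrix F n) {idx hn 0, idx hn 1} {idx hn 2, idx hn 3}).rank = 1 := by
    refine rank_block_eq_one (fun _ => 1) (fun _ => 1) ?_ (s := idx hn 0) (t := idx hn 2)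
      (by simp) (by simp) (by simp [hA.1, leadingBlock])
    intro s hs t ht
    simp only [Finset.mem_insert, Finset.mem_singleton] at hs ht
    rcases hs with rfl | rfl <;> rcases ht with rfl | rfl <;> simp [hA.1, leadingBlock]
  have hno : ¬ ∃ X : Finset (Fin n),
      idx hn 0 ∈ X ∧ idx hn 1 ∈ X ∧ idx hn 2 ∈ Xᶜ ∧ idx hn 3 ∈ Xᶜ ∧
        (block (explicitMatrix F n) X Xᶜ).rank = 1 := by
    rintro ⟨X, h0, h1, h2, h3, hX⟩
    exact not_rank_block_explicitMatrix_le_one hn hn5 X h0 h1 h2 h3 hX.le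
  have hcut : ¬ ∃ X : Finset (Fin n), IsCut (explicitMatrix F n) X ∧
      idx hn 0 ∈ X ∧ idx hn 1 ∈ X ∧ idx hn 2 ∈ Xᶜ ∧ idx hn 3 ∈ Xᶜ := by
    rintro ⟨X, hX, h0, h1, h2, h3⟩
    exact not_rank_block_explicitMatrix_le_one hn hn5 X h0 h1 h2 h3 hX.2.2.1
  have hne (p q : Fin 4) (h : p ≠ q) : idx hn p ≠ idx hn q := (idx_injective hn).ne h
  refine ⟨hD, hD.swapEntries, hA, hrank, hno, fun hext => hno ?_, hcut,
    pmeUpTo_explicitMatrix_swap hn, pmeUpTo_four_swap hA, not_pme_swap hA hcut⟩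
  exact hext _ _ _ _ (hne 0 1 (by decide)) (hne 0 2 (by decide)) (hne 0 3 (by decide))
    (hne 1 2 (by decide)) (hne 1 3 (by decide)) (hne 2 3 (by decide)) hrank
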